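/- Let $U$ be a finite set and let $\mathcal L\subseteq\{-1,0,+1\}^U$ be a complex of oriented matroids (COM). That is, for all $X,Y\in\mathcal L$ one has $X\circ(-Y)\in\mathcal L$, and for every $e\in S(X,Y)$ there is $Z\in\mathcal L$ with $Z_e=0$ and $Z_f=(X\circ Y)_f$ for all $f\notin S(X,Y)$. Here $(X\circ Y)_e=X_e$ if $X_e\neq0$ and $(X\circ Y)_e=Y_e$ otherwise, and $S(X,Y)=\{e: X_eY_e=-1\}$. Assume that $\mathcal L$ is simple: $\{X_e:X\in\mathcal L\}=\{-1,0,+1\}$ for every $e\in U$, and for all $e\ne f$ in $U$ there are $X,Y\in\mathcal L$ with $X_eX_f=+1$ and $Y_eY_f=-1$. Faces, topes and half-carriers are defined as follows. The face of $X\in\mathcal L$ is $F(X)=\{X\circ Y:Y\in\mathcal L\}$. It is regarded as a system of sign vectors on the zero set $X^0=\{e:X_e=0\}$ when we ask whether it is an oriented matroid (OM), i.e. closed under $\circ$ and under negation and satisfying the second axiom above. The topes of a system of sign vectors are its maximal elements with respect to the product order given by $0\le-1$ and $0\le+1$. A tope $T$ is identified with the set $\{e\in U:T_e=+1\}$, and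 the tope graph is the subgraph of the hypercube $Q(U)$ induced by the topes. The half-carriers of $\mathcal L$ are, for $e\in U$ and $s\in\{+1,-1\}$, the sets of all $Y\in\mathcal L$ with $Y_e=s$ that lie in a face $F(X)$ with $X\in\mathcal L$ and $X_e=0$. A uniform oriented matroid (UOM) of rank $r$ on an $m$-element set, $0\le r\le m$, is a simple OM whose cocircuits (minimal nonzero elements) are exactly two opposite signings of each subset of size $m-r+1$. A complex of uniform oriented matroids (CUOM) is a simple COM each of whose inclusion-maximal faces is a UOM (of some rank). A set family $\mathcal S\subseteq2^U$ is ample if $|\mathcal S|$ equals the number of subsets of $U$ shattered by $\mathcal S$, and an ample partial cube is a subgraph of $Q(U)$ induced by an ample family and isometric in $Q(U)$. Then the following are equivalent: (i) $\mathcal L$ is a CUOM; (ii) the tope graph of every face of $\mathcal L$ that is not inclusion-maximal among the faces of $\mathcal L$ is a hypercube (isomorphic to some $Q_n$, $n\ge0$); (iii) for every half-carrier of $\mathcal L$, its tope graph is an ample partial cube. -/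

import Mathlib

namespace SignSystem

variable {U : Type*}

/-! ### Sign vectors -/

/-- The product order on sign vectors relative to `0 ≤ -1`, `0 ≤ +1`
(this is not Mathlib's linear order on `SignType`). -/
def SignLE (X Y : U → SignType) : Prop := ∀ e, X e = 0 ∨ X e = Y e

/-- The composition `X ∘ Y`. -/
def comp (X Y : U → SignType) : U → SignType :=
  fun e => if X e = 0 then Y e else X e

/-- The separator `S(X,Y)`. -/
def sep (X Y : U → SignType) : Set U := {e | X e * Y e = -1}

/-! ### Axioms for systems of sign vectors -/

/-- Composition (C). -/
def Composition (L : Set (U → SignType)) : Prop :=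
  ∀ X ∈ L, ∀ Y ∈ L, comp X Y ∈ L

/-- Strong elimination (SE). -/
def StrongElimination (L : Set (U → SignType)) : Prop :=
  ∀ X ∈ L, ∀ Y ∈ L, ∀ e ∈ sep X Y, ∃ Z ∈ L, Z e = 0 ∧ ∀ f, f ∉ sep X Y → Z f = comp X Y f

/-- Symmetry (Sym). -/
def Symmetry (L : Set (U → SignType)) : Prop :=
  ∀ X ∈ L, -X ∈ L

/-- Face symmetry (FS). -/
def FaceSymmetry (L : Set (U → SignType)) : Prop :=
  ∀ X ∈ L, ∀ Y ∈ L, comp X (-Y) ∈ L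

/-- Simple systems: every element takes all three signs, and no two distinct elements are
parallel or antiparallel. -/
structure IsSimple (L : Set (U → SignType)) : Prop where
  all_signs : ∀ (e : U) (s : SignType), ∃ X ∈ L, X e = s
  no_parallel : ∀ e f : U, e ≠ f → ∃ X ∈ L, ∃ Y ∈ L, X e * X f = 1 ∧ Y e * Y f = -1

/-- Oriented matroids, given by their covectors. -/
structure IsOM (L : Set (U → SignType)) : Prop where
  composition : Composition L
  strong_elimination : StrongElimination L
  symmetry : Symmetry L

/-- Complexes of oriented matroids. -/
structure IsCOM (L : Set (U → SignType)) : Prop where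
  strong_elimination : StrongElimination L
  face_symmetry : FaceSymmetry L

/-! ### Uniform oriented matroids -/

/-- The support of a sign vector. -/
def support [Fintype U] (X : U → SignType) : Finset U := Finset.univ.filter fun e => X e ≠ 0

/-- Cocircuits: the minimal nonzero covectors. -/
def cocircuits (L : Set (U → SignType)) : Set (U → SignType) :=
  {X | X ∈ L ∧ X ≠ 0 ∧ ∀ Y ∈ L, Y ≠ 0 → SignLE Y X → Y = X}

/-- A uniform oriented matroid of rank `r` on the `m`-element set `U`: a simple oriented matroid
whose cocircuits are exactly two opposite signings of each subset of `U` of size `m - r + 1`. -/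
structure IsUOMOfRank [Fintype U] (r : ℕ) (L : Set (U → SignType)) : Prop where
  isOM : IsOM L
  simple : IsSimple L
  rank_le : r ≤ Fintype.card U
  card_support : ∀ X ∈ cocircuits L, (support X).card + r = Fintype.card U + 1
  two_signings : ∀ A : Finset U, A.card + r = Fintype.card U + 1 →
    ∃ X, support X = A ∧ {Y | Y ∈ cocircuits L ∧ support Y = A} = {X, -X}

/-- A uniform oriented matroid (of some rank). -/
def IsUOM [Fintype U] (L : Set (U → SignType)) : Prop := ∃ r, IsUOMOfRank r L

/-! ### Faces and complexes of uniform oriented matroids -/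

/-- The face `F(X) = {X ∘ Y : Y ∈ L}`. -/
def face (L : Set (U → SignType)) (X : U → SignType) : Set (U → SignType) :=
  {Z | ∃ Y ∈ L, Z = comp X Y}

/-- `F` is a face of `L`. -/
def IsFace (L F : Set (U → SignType)) : Prop := ∃ X ∈ L, F = face L X

/-- The face `F(X)` as a system of sign vectors on the zero set of `X` (all members of `F(X)`
coincide with `X` on the support of `X`). -/
def faceSystem (L : Set (U → SignType)) (X : U → SignType) : Set ({e // X e = 0} → SignType) :=
  {Z | ∃ Y ∈ face L X, Z = fun e => Y e.1}

/-- Complexes of uniform oriented matroids: (simple) COMs all of whose inclusion-maximal faces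
are uniform oriented matroids. -/
structure IsCUOM [Fintype U] (L : Set (U → SignType)) : Prop where
  isCOM : IsCOM L
  simple : IsSimple L
  uniform : ∀ X ∈ L, Maximal (IsFace L) (face L X) → IsUOM (faceSystem L X)

/-! ### Topes and tope graphs -/

/-- Topes: the maximal covectors. -/
def IsTope (L : Set (U → SignType)) (T : U → SignType) : Prop :=
  T ∈ L ∧ ∀ Y ∈ L, SignLE T Y → Y = T

open Classical in
/-- The topes of `L`, viewed as a family of subsets of `U`: a tope `T` gives `{e | T e = +1}`. -/
noncomputable def topeFamily [Fintype U] (L : Set (U → SignType)) : Finset (Finset U) :=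
  Finset.univ.filter fun A => ∃ T, IsTope L T ∧ A = Finset.univ.filter fun e => T e = 1

/-- The hypercube `Q(U)`: subsets of `U`, adjacent when they differ in exactly one element. -/
def hypercube (U : Type*) [DecidableEq U] : SimpleGraph (Finset U) where
  Adj A B := (symmDiff A B).card = 1
  symm := ⟨fun A B h => by rwa [symmDiff_comm]⟩
  loopless := ⟨fun A h => by simp at h⟩

/-- The 1-inclusion graph of a set family: the subgraph of the hypercube induced by it. -/
def inclusionGraph [DecidableEq U] (S : Finset (Finset U)) :
    SimpleGraph (S : Set (Finset U)) :=
  (hypercube U).induce (S : Set (Finset U))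

/-- The tope graph: the 1-inclusion graph of the family of topes. -/
noncomputable def topeGraph [Fintype U] [DecidableEq U] (L : Set (U → SignType)) :
    SimpleGraph (topeFamily L : Set (Finset U)) :=
  inclusionGraph (topeFamily L)

/-- A graph that is (isomorphic to) a finite-dimensional hypercube. -/
def IsHypercube {V : Type*} (G : SimpleGraph V) : Prop :=
  ∃ n : ℕ, Nonempty (G ≃g hypercube (Fin n))

/-! ### Ample partial cubes -/

/-- A set family is ample if the upper bound in the sandwich lemma is tight: it has as many
members as there are sets that it shatters. -/
def IsAmple [DecidableEq U] (S : Finset (Finset U)) : Prop := S.card = S.shatterer.card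

/-- The 1-inclusion graph of the family is an isometric subgraph of the hypercube. -/
def IsIsometric [DecidableEq U] (S : Finset (Finset U)) : Prop :=
  ∀ A B : (S : Set (Finset U)), (inclusionGraph S).dist A B = (hypercube U).dist A.1 B.1

/-- The 1-inclusion graph of the family is an ample partial cube. -/
structure IsAmplePartialCube [DecidableEq U] (S : Finset (Finset U)) : Prop where
  isometric : IsIsometric S
  ample : IsAmple S

/-! ### Half-carriers -/

/-- The carrier of the hyperplane `{X ∈ L : X e = 0}`: the union of the faces `F(X)` over it. -/
def carrier (L : Set (U → SignType)) (e : U) : Set (U → SignType) :=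
  {Y | ∃ X ∈ L, X e = 0 ∧ Y ∈ face L X}

/-- The positive half-carrier of `e`. -/
def posHalfCarrier (L : Set (U → SignType)) (e : U) : Set (U → SignType) :=
  {Y | Y ∈ L ∧ Y e = 1} ∩ carrier L e

/-- The negative half-carrier of `e`. -/
def negHalfCarrier (L : Set (U → SignType)) (e : U) : Set (U → SignType) :=
  {Y | Y ∈ L ∧ Y e = -1} ∩ carrier L e

end SignSystem

namespace SignSystem

variable {U : Type*}

/-! ### Ample set families -/

section Ample

variable [DecidableEq U]

/-! All three conditions are shown equivalent to `HasFullProperFaces`: whenever X < Y in L, every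
sign vector above Y belongs to L. Two general facts are used throughout. Face symmetry makes the
face of Y antipodal on the zero set of Y. Strong elimination produces zeros from opposite signs, so
a face containing all its possible topes is full.

(i) Covectors above X correspond to covectors of the face of X, with X itself becoming 0, so the
claim is that a simple OM is uniform iff the faces of its nonzero covectors are full. In a UOM, any
zero of Y ≠ 0 can be filled alone by a cocircuit whose other support lies in that of Y
(`IsUOMOfRank.isFullAt`). Conversely, fullness and elimination give an exchange property for
supports of minimal size k, so all k-sets are supports and no cocircuit is larger
(`isUOM_of_isFullAt`).

(ii) Antipodal topes of the face of Y differ on its whole zero set, so a hypercube tope graph has at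
least that dimension, and counting forces every possible tope to occur (`isFullAt_of_isHypercube`).

(iii) Half-carriers satisfy strong elimination. Hence a set shattered by the topes is the zero
pattern of some Z in the half-carrier; Z lies strictly above a covector, its full face supplies a
cube, and ampleness follows (`isAmple_halfCarrier`). Conversely, the topes of a face in an ample
half-carrier form an ample antipodal family, which must be a whole cube
(`isFullAt_of_isAmple_halfCarrier`). Isometry is automatic for ample families. -/

lemma shatters_iff_forall_exists {S : Finset (Finset U)} {A : Finset U} :
    S.Shatters A ↔ ∀ u : Finset U, ∃ B ∈ S, ∀ x ∈ A, x ∈ B ↔ x ∈ u := by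
  constructor
  · intro h u
    obtain ⟨B, hB, hAB⟩ := h (Finset.inter_subset_left (s₁ := A) (s₂ := u))
    refine ⟨B, hB, fun x hx => ?_⟩
    have := congrArg (fun s => x ∈ s) hAB
    simpa [hx] using this
  · intro h u hu
    obtain ⟨B, hB, hAB⟩ := h u
    refine ⟨B, hB, ?_⟩
    ext x
    rw [Finset.mem_inter]
    exact ⟨fun hx => (hAB x hx.1).1 hx.2, fun hx => ⟨hu hx, (hAB x (hu hx)).2 hx⟩⟩

/-- Members of a shattered set cannot be constant on the family. -/
lemma notMem_of_shatters_of_const {S : Finset (Finset U)} {A : Finset U} {a : U} {p : Prop}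
    (hS : ∀ B ∈ S, a ∈ B ↔ p) (hA : S.Shatters A) : a ∉ A := by
  intro ha
  rw [shatters_iff_forall_exists] at hA
  obtain ⟨B, hB, h1⟩ := hA {a}
  obtain ⟨C, hC, h2⟩ := hA ∅
  have h3 := h1 a ha
  have h4 := h2 a ha
  rw [hS B hB] at h3
  rw [hS C hC, h3] at h4
  simp at h4

/-- Splitting an ample family along an element: both halves are ample, and a shattered set
avoiding the element is shattered by one of the halves. -/
lemma IsAmple.split {S : Finset (Finset U)} (hS : IsAmple S) (a : U) :
    IsAmple (S.filter (a ∈ ·)) ∧ IsAmple (S.filter (a ∉ ·)) ∧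
      ∀ A, a ∉ A → S.Shatters A →
        (S.filter (a ∈ ·)).Shatters A ∨ (S.filter (a ∉ ·)).Shatters A := by
  set S₁ := S.filter (a ∈ ·) with hS₁
  set S₀ := S.filter (a ∉ ·) with hS₀
  have hn₁ : ∀ A, S₁.Shatters A → a ∉ A := fun A =>
    notMem_of_shatters_of_const (p := True) (by simp [hS₁])
  have hn₀ : ∀ A, S₀.Shatters A → a ∉ A := fun A =>
    notMem_of_shatters_of_const (p := False) (by simp [hS₀])
  -- Sets shattered by both halves remain shattered after adding `a`. Thus |S| = |S₁| + |S₀| ≤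
  -- |union| + |intersection| of the two shatterers = |union| + |I| ≤ |shatterer of S|, and
  -- ampleness turns every inequality into an equality.
  set I := (S₁.shatterer ∩ S₀.shatterer).image (insert a) with hI
  have hIcard : I.card = (S₁.shatterer ∩ S₀.shatterer).card := by
    apply Finset.card_image_of_injOn
    intro A hA B hB hAB
    simp only [Finset.coe_inter, Set.mem_inter_iff, Finset.mem_coe, Finset.mem_shatterer] at hA hB
    rw [← Finset.erase_insert (hn₁ A hA.1), ← Finset.erase_insert (hn₁ B hB.1)]
    exact congrArg (fun s => s.erase a) hAB
  have hdisj : Disjoint (S₁.shatterer ∪ S₀.shatterer) I := by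
    rw [Finset.disjoint_left]
    intro A hA hAI
    obtain ⟨B, -, rfl⟩ := Finset.mem_image.1 hAI
    rw [Finset.mem_union, Finset.mem_shatterer, Finset.mem_shatterer] at hA
    rcases hA with hA | hA
    · exact hn₁ _ hA (Finset.mem_insert_self a B)
    · exact hn₀ _ hA (Finset.mem_insert_self a B)
  have hsub : (S₁.shatterer ∪ S₀.shatterer) ∪ I ⊆ S.shatterer := by
    intro A hA
    simp only [Finset.mem_union, Finset.mem_shatterer] at hA ⊢
    rcases hA with (hA | hA) | hA
    · exact hA.mono_left (Finset.filter_subset _ _)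
    · exact hA.mono_left (Finset.filter_subset _ _)
    · obtain ⟨B, hB, rfl⟩ := Finset.mem_image.1 hA
      rw [Finset.mem_inter, Finset.mem_shatterer, Finset.mem_shatterer,
        shatters_iff_forall_exists, shatters_iff_forall_exists] at hB
      rw [shatters_iff_forall_exists]
      intro u
      by_cases ha : a ∈ u
      · obtain ⟨C, hC, hCu⟩ := hB.1 u
        rw [hS₁, Finset.mem_filter] at hC
        exact ⟨C, hC.1, by simpa [ha, hC.2] using hCu⟩
      · obtain ⟨C, hC, hCu⟩ := hB.2 u
        rw [hS₀, Finset.mem_filter] at hC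
        exact ⟨C, hC.1, by simpa [ha, hC.2] using hCu⟩
  have hcard : S₁.card + S₀.card = S.card := Finset.card_filter_add_card_filter_not _
  have h₁ := Finset.card_le_card_shatterer S₁
  have h₀ := Finset.card_le_card_shatterer S₀
  have hu := Finset.card_union_add_card_inter S₁.shatterer S₀.shatterer
  have hd := Finset.card_union_of_disjoint hdisj
  have hle := Finset.card_le_card hsub
  have hS' : S.card = S.shatterer.card := hS
  refine ⟨show S₁.card = _ by omega, show S₀.card = _ by omega, fun A haA hA => ?_⟩
  have heq : (S₁.shatterer ∪ S₀.shatterer) ∪ I = S.shatterer :=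
    Finset.eq_of_subset_of_card_le hsub (by omega)
  have hmem : A ∈ (S₁.shatterer ∪ S₀.shatterer) ∪ I := by
    rw [heq, Finset.mem_shatterer]
    exact hA
  simp only [Finset.mem_union, Finset.mem_shatterer] at hmem
  rcases hmem with h | h
  · exact h
  · obtain ⟨B, -, rfl⟩ := Finset.mem_image.1 h
    exact absurd (Finset.mem_insert_self a B) haA

/-- The members of an ample family that lie in a given subcube form an ample family. -/
lemma IsAmple.exists_subcube {S : Finset (Finset U)} (hS : IsAmple S) (P t : Finset U) :
    ∃ S' : Finset (Finset U), (∀ A, A ∈ S' ↔ A ∈ S ∧ ∀ x ∈ t, x ∈ A ↔ x ∈ P) ∧ IsAmple S' := by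
  induction t using Finset.induction_on with
  | empty => exact ⟨S, by simp, hS⟩
  | insert a t _ ih =>
    obtain ⟨S', hS', ih⟩ := ih
    obtain ⟨h₁, h₀, -⟩ := ih.split a
    by_cases ha : a ∈ P
    · refine ⟨_, fun A => ?_, h₁⟩
      simp only [Finset.mem_filter, Finset.forall_mem_insert, ha, iff_true, hS']
      tauto
    · refine ⟨_, fun A => ?_, h₀⟩
      simp only [Finset.mem_filter, Finset.forall_mem_insert, ha, iff_false, hS']
      tauto

/-- Sets shattered by an ample family are strongly shattered. -/
lemma IsAmple.exists_cube [Fintype U] {S : Finset (Finset U)} (hS : IsAmple S) {A : Finset U}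
    (hA : S.Shatters A) : ∃ B ∈ S, ∀ C : Finset U, (∀ x, x ∉ A → (x ∈ C ↔ x ∈ B)) → C ∈ S := by
  -- Split along each element outside `A`, always keeping a half that still shatters `A`. What
  -- remains is constant off `A`, hence a cube.
  have key : ∀ t : Finset U, Disjoint t A → ∃ S' ⊆ S, IsAmple S' ∧ S'.Shatters A ∧
      ∀ B ∈ S', ∀ C ∈ S', ∀ x ∈ t, x ∈ C ↔ x ∈ B := by
    intro t
    induction t using Finset.induction_on with
    | empty => exact fun _ => ⟨S, Finset.Subset.refl S, hS, hA, by simp⟩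
    | insert a t _ ih =>
      intro hd
      rw [Finset.disjoint_insert_left] at hd
      obtain ⟨S', hsub, hamp, hsh, hc⟩ := ih hd.2
      obtain ⟨h₁, h₀, h⟩ := hamp.split a
      rcases h A hd.1 hsh with h | h
      · refine ⟨_, (Finset.filter_subset _ _).trans hsub, h₁, h, fun B hB C hC x hx => ?_⟩
        rw [Finset.mem_filter] at hB hC
        rcases Finset.mem_insert.1 hx with rfl | hx
        · simp [hB.2, hC.2]
        · exact hc B hB.1 C hC.1 x hx
      · refine ⟨_, (Finset.filter_subset _ _).trans hsub, h₀, h, fun B hB C hC x hx => ?_⟩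
        rw [Finset.mem_filter] at hB hC
        rcases Finset.mem_insert.1 hx with rfl | hx
        · simp [hB.2, hC.2]
        · exact hc B hB.1 C hC.1 x hx
  obtain ⟨S', hsub, -, hsh, hc⟩ := key Aᶜ disjoint_compl_left
  obtain ⟨B, hB⟩ := hsh.nonempty
  refine ⟨B, hsub hB, fun C hC => ?_⟩
  obtain ⟨D, hD, hDC⟩ := shatters_iff_forall_exists.1 hsh C
  have : D = C := by
    ext x
    by_cases hx : x ∈ A
    · exact hDC x hx
    · rw [hC x hx]
      exact hc B hB D hD x (Finset.mem_compl.2 hx)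
  exact this ▸ hsub hD

/-- A family that strongly shatters every set it shatters is ample. -/
lemma isAmple_of_forall_exists_cube [Fintype U] {S : Finset (Finset U)}
    (h : ∀ A, S.Shatters A → ∃ B : Finset U, ∀ C : Finset U, (∀ x, x ∉ A → (x ∈ C ↔ x ∈ B)) → C ∈ S) :
    IsAmple S := by
  refine le_antisymm (Finset.card_le_card_shatterer S) ?_
  -- A cube in S with directions `A` means that its trace on the complement of `A` is missing from
  -- `Sᶜ`. So `Aᶜ` is not shattered by `Sᶜ`, and the sandwich inequality for `Sᶜ` bounds the
  -- shatterer of S from above.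
  have hle : S.shatterer.card ≤ (Sᶜ.shatterer)ᶜ.card := by
    apply Finset.card_le_card_of_injOn (fun A => Aᶜ)
    · intro A hA
      rw [Finset.mem_coe, Finset.mem_shatterer] at hA
      rw [Finset.mem_coe, Finset.mem_compl, Finset.mem_shatterer, shatters_iff_forall_exists]
      intro hs
      obtain ⟨B, hB⟩ := h A hA
      obtain ⟨C, hC, hCB⟩ := hs B
      exact (Finset.mem_compl.1 hC) (hB C fun x hx => hCB x (Finset.mem_compl.2 hx))
    · exact fun A _ B _ hAB => compl_injective hAB
  have h1 := Finset.card_le_card_shatterer Sᶜ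
  have h2 := Finset.card_add_card_compl S
  have h3 := Finset.card_add_card_compl Sᶜ.shatterer
  omega

/-- A nonempty ample family closed under switching the elements of `Z` shatters `Z`. -/
lemma IsAmple.shatters_of_antipodal [Fintype U] {S : Finset (Finset U)} (hS : IsAmple S)
    (hne : S.Nonempty) {Z : Finset U} (hZ : ∀ B ∈ S, symmDiff B Z ∈ S) : S.Shatters Z := by
  suffices ∀ A : Finset U, A ⊆ Z → S.Shatters A from this Z (Finset.Subset.refl Z)
  intro A
  induction A using Finset.induction_on with
  | empty => exact fun _ => Finset.shatters_empty.2 hne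
  | insert a A haA ih =>
    intro hsub
    rw [Finset.insert_subset_iff] at hsub
    obtain ⟨B, hB, hcube⟩ := hS.exists_cube (ih hsub.2)
    rw [shatters_iff_forall_exists]
    intro u
    by_cases ha : a ∈ B ↔ a ∈ u
    · refine ⟨(B \ A) ∪ (u ∩ A), hcube _ fun x hx => by simp [hx], ?_⟩
      intro x hx
      rcases Finset.mem_insert.1 hx with rfl | hx
      · simpa [haA] using ha
      · simp [hx]
    -- The cube has the wrong value at `a`: take the opposite of the desired pattern on `A` and
    -- switch all of `Z`, which corrects `A` and `a` together.
    · refine ⟨symmDiff ((B \ A) ∪ (A \ u)) Z, hZ _ (hcube _ fun x hx => by simp [hx]), ?_⟩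
      intro x hx
      rcases Finset.mem_insert.1 hx with rfl | hx
      · simp only [Finset.mem_symmDiff, Finset.mem_union, Finset.mem_sdiff, haA, hsub.1]
        tauto
      · have := hsub.2 hx
        simp only [Finset.mem_symmDiff, Finset.mem_union, Finset.mem_sdiff, hx, this]
        tauto

/-! ### Distances in hypercubes -/

/-- The labelling `φ` is arbitrary so that the bound also applies to the inverse of an isomorphism
from a tope graph to a cube. -/
lemma card_symmDiff_le_length {V : Type*} {G : SimpleGraph V} {φ : V → Finset U}
    (hφ : ∀ v w, G.Adj v w → (symmDiff (φ v) (φ w)).card ≤ 1) {v w : V} (p : G.Walk v w) :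
    (symmDiff (φ v) (φ w)).card ≤ p.length := by
  induction p with
  | nil => simp
  | @cons u v w h p ih =>
    have h1 : symmDiff (φ u) (φ w) ⊆ symmDiff (φ u) (φ v) ∪ symmDiff (φ v) (φ w) :=
      symmDiff_triangle _ _ _
    have h2 := (Finset.card_le_card h1).trans (Finset.card_union_le _ _)
    have h3 := hφ u v h
    rw [SimpleGraph.Walk.length_cons]
    omega

lemma exists_walk_hypercube (A B : Finset U) :
    ∃ p : (hypercube U).Walk A B, p.length = (symmDiff A B).card := by
  induction hn : (symmDiff A B).card generalizing A with
  | zero =>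
    have : A = B := by simpa using hn
    subst this
    exact ⟨SimpleGraph.Walk.nil, rfl⟩
  | succ n ih =>
    obtain ⟨a, ha⟩ := Finset.card_pos.1 (by omega : 0 < (symmDiff A B).card)
    have h1 : symmDiff (symmDiff A {a}) B = (symmDiff A B).erase a := by
      ext x
      simp only [Finset.mem_symmDiff, Finset.mem_singleton, Finset.mem_erase] at ha ⊢
      by_cases hx : x = a
      · subst hx; tauto
      · tauto
    obtain ⟨p, hp⟩ := ih (symmDiff A {a}) (by rw [h1, Finset.card_erase_of_mem ha, hn]; rfl)
    have hadj : (hypercube U).Adj A (symmDiff A {a}) := by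
      change (symmDiff A (symmDiff A {a})).card = 1
      rw [symmDiff_symmDiff_cancel_left, Finset.card_singleton]
    exact ⟨SimpleGraph.Walk.cons hadj p, by rw [SimpleGraph.Walk.length_cons, hp]⟩

lemma hypercube_dist (A B : Finset U) :
    (hypercube U).dist A B = (symmDiff A B).card := by
  obtain ⟨p, hp⟩ := exists_walk_hypercube A B
  refine le_antisymm (hp ▸ SimpleGraph.dist_le p) ?_
  obtain ⟨q, hq⟩ := p.reachable.exists_walk_length_eq_dist
  rw [← hq]
  exact card_symmDiff_le_length (φ := id) (fun v w h => le_of_eq h) q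

/-- Between any two members of an ample family that are not neighbours lies a third one. -/
lemma IsAmple.exists_between [Fintype U] {S : Finset (Finset U)} (hS : IsAmple S)
    {A B : Finset U} (hA : A ∈ S) (hB : B ∈ S) (hAB : 1 < (symmDiff A B).card) :
    ∃ C ∈ S, C ≠ A ∧ C ≠ B ∧ (symmDiff A C).card + (symmDiff C B).card = (symmDiff A B).card := by
  obtain ⟨S', hmem, hS'⟩ := hS.exists_subcube A (symmDiff A B)ᶜ
  have hbetween : ∀ C ∈ S',
      (symmDiff A C).card + (symmDiff C B).card = (symmDiff A B).card := by
    intro C hC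
    rw [← Finset.card_union_of_disjoint]
    · congr 1
      ext x
      have := ((hmem C).1 hC).2 x
      simp only [Finset.mem_compl, Finset.mem_union, Finset.mem_symmDiff] at this ⊢
      tauto
    · rw [Finset.disjoint_left]
      intro x
      have := ((hmem C).1 hC).2 x
      simp only [Finset.mem_compl, Finset.mem_symmDiff] at this ⊢
      tauto
  have hAS' : A ∈ S' := (hmem _).2 ⟨hA, by simp⟩
  have hBS' : B ∈ S' := (hmem _).2 ⟨hB, fun x hx => by
    simp only [Finset.mem_compl, Finset.mem_symmDiff] at hx; tauto⟩
  obtain ⟨a, ha⟩ := Finset.card_pos.1 (by omega : 0 < (symmDiff A B).card)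
  have hsh : S'.Shatters {a} := by
    rw [shatters_iff_forall_exists]
    intro u
    by_cases h : a ∈ A ↔ a ∈ u
    · exact ⟨A, hAS', by simpa using h⟩
    · refine ⟨B, hBS', ?_⟩
      rw [Finset.mem_symmDiff] at ha
      intro x hx
      rw [Finset.mem_singleton.1 hx]
      tauto
  -- An edge in direction `a` inside the interval from `A` to `B`. As `A` and `B` are not adjacent,
  -- one of its ends is neither of them.
  obtain ⟨C, hC, hcube⟩ := hS'.exists_cube hsh
  have hD : symmDiff C {a} ∈ S' := hcube _ fun x hx => by
    simp [Finset.mem_symmDiff, Finset.mem_singleton.not.1 hx]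
  have hcard : ∀ D : Finset U, (symmDiff D (symmDiff D {a})).card = 1 := fun D => by
    rw [symmDiff_symmDiff_cancel_left, Finset.card_singleton]
  by_cases hCA : C = A
  · refine ⟨_, ((hmem _).1 hD).1, fun h => ?_, fun h => ?_, hbetween _ hD⟩
    · have := hcard C
      rw [h, hCA] at this
      simp at this
    · have := hcard C
      rw [h, hCA] at this
      omega
  · by_cases hCB : C = B
    · refine ⟨_, ((hmem _).1 hD).1, fun h => ?_, fun h => ?_, hbetween _ hD⟩
      · have := hcard C
        rw [h, hCB, symmDiff_comm] at this
        omega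
      · have := hcard C
        rw [h, hCB] at this
        simp at this
    · exact ⟨C, ((hmem C).1 hC).1, hCA, hCB, hbetween C hC⟩

lemma IsAmple.isIsometric [Fintype U] {S : Finset (Finset U)} (hS : IsAmple S) :
    IsIsometric S := by
  have key : ∀ n, ∀ A B : (S : Set (Finset U)), (symmDiff A.1 B.1).card = n →
      ∃ p : (inclusionGraph S).Walk A B, p.length = n := by
    intro n
    induction n using Nat.strong_induction_on with
    | _ n ih =>
      intro A B hn
      by_cases h0 : A = B
      · subst h0
        have : n = 0 := by rw [← hn]; simp
        exact ⟨SimpleGraph.Walk.nil, by simp [this]⟩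
      have hpos : ∀ C D : Finset U, C ≠ D → 0 < (symmDiff C D).card := fun C D h =>
        Finset.card_pos.2 (Finset.symmDiff_nonempty.2 h)
      by_cases h1 : n = 1
      · have hadj : (inclusionGraph S).Adj A B := hn.trans h1
        exact ⟨SimpleGraph.Walk.cons hadj SimpleGraph.Walk.nil, by simp [h1]⟩
      have h2 := hpos A.1 B.1 fun h => h0 (Subtype.ext h)
      obtain ⟨C, hC, hCA, hCB, hsum⟩ := hS.exists_between A.2 B.2 (by omega)
      have h3 := hpos A.1 C hCA.symm
      have h4 := hpos C B.1 hCB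
      obtain ⟨p, hp⟩ := ih (symmDiff A.1 C).card (by omega) A ⟨C, hC⟩ rfl
      obtain ⟨q, hq⟩ := ih (symmDiff C B.1).card (by omega) ⟨C, hC⟩ B rfl
      exact ⟨p.append q, by rw [SimpleGraph.Walk.length_append, hp, hq, hsum, hn]⟩
  intro A B
  rw [hypercube_dist]
  obtain ⟨p, hp⟩ := key _ A B rfl
  refine le_antisymm (hp ▸ SimpleGraph.dist_le p) ?_
  obtain ⟨q, hq⟩ := p.reachable.exists_walk_length_eq_dist
  rw [← hq]
  exact card_symmDiff_le_length (φ := Subtype.val) (fun v w h => le_of_eq h) q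

end Ample

/-! ### Composition, faces and topes -/

lemma comp_apply_of_eq_zero {X : U → SignType} {e : U} (h : X e = 0) (Y : U → SignType) :
    comp X Y e = Y e := by simp [comp, h]

lemma comp_apply_of_ne_zero {X : U → SignType} {e : U} (h : X e ≠ 0) (Y : U → SignType) :
    comp X Y e = X e := by simp [comp, h]

lemma comp_assoc (X Y Z : U → SignType) : comp (comp X Y) Z = comp X (comp Y Z) := by
  funext e
  by_cases h : X e = 0 <;> simp [comp, h]

lemma signLE_comp (X Y : U → SignType) : SignLE X (comp X Y) := fun e => by
  by_cases h : X e = 0 <;> simp [comp, h]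

lemma SignLE.comp_eq {X Y : U → SignType} (h : SignLE X Y) : comp X Y = Y := by
  funext e
  rcases h e with h | h <;> simp [comp, h]

lemma SignLE.refl (X : U → SignType) : SignLE X X := fun _ => Or.inr rfl

lemma SignLE.trans {X Y Z : U → SignType} (h : SignLE X Y) (h' : SignLE Y Z) : SignLE X Z := by
  intro e
  rcases h e with h | h
  · exact Or.inl h
  · rcases h' e with h' | h'
    · exact Or.inl (h.trans h')
    · exact Or.inr (h.trans h')

lemma SignLE.apply_eq {X Y : U → SignType} (h : SignLE X Y) {e : U} (he : X e ≠ 0) : Y e = X e :=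
  ((h e).resolve_left he).symm

lemma SignLE.apply_ne_zero {X Y : U → SignType} (h : SignLE X Y) {e : U} (he : X e ≠ 0) :
    Y e ≠ 0 := by rwa [h.apply_eq he]

lemma mem_sep_iff {X Y : U → SignType} {e : U} : e ∈ sep X Y ↔ X e ≠ 0 ∧ Y e = -X e := by
  change X e * Y e = -1 ↔ _
  generalize X e = x
  generalize Y e = y
  revert x y
  decide

lemma sign_ne_neg {s : SignType} (h : s ≠ 0) : s ≠ -s := by
  revert s; decide

lemma sign_eq_or_eq_neg {s t : SignType} (hs : s ≠ 0) (ht : t ≠ 0) : s = t ∨ s = -t := by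
  revert s t; decide

lemma IsCOM.composition {L : Set (U → SignType)} (hL : IsCOM L) : Composition L := by
  intro X hX Y hY
  have h := hL.face_symmetry X hX _ (hL.face_symmetry X hX Y hY)
  convert h using 1
  funext e
  by_cases he : X e = 0 <;> simp [comp, he]

lemma mem_face_iff {L : Set (U → SignType)} (hL : Composition L) {X Z : U → SignType}
    (hX : X ∈ L) : Z ∈ face L X ↔ Z ∈ L ∧ SignLE X Z := by
  constructor
  · rintro ⟨Y, hY, rfl⟩
    exact ⟨hL X hX Y hY, signLE_comp X Y⟩
  · rintro ⟨hZ, h⟩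
    exact ⟨Z, hZ, h.comp_eq.symm⟩

lemma face_subset_face_iff {L : Set (U → SignType)} (hL : Composition L) {X Y : U → SignType}
    (hX : X ∈ L) (hY : Y ∈ L) : face L Y ⊆ face L X ↔ SignLE X Y := by
  constructor
  · intro h
    exact ((mem_face_iff hL hX).1 (h ((mem_face_iff hL hY).2 ⟨hY, SignLE.refl Y⟩))).2
  · intro h Z hZ
    rw [mem_face_iff hL hY] at hZ
    exact (mem_face_iff hL hX).2 ⟨hZ.1, h.trans hZ.2⟩

/-- Members of the face agree on the support of `Y`, so elimination leaves that part untouched. -/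
lemma strongElimination_face {L : Set (U → SignType)} (hL : IsCOM L) {Y : U → SignType}
    (hY : Y ∈ L) : StrongElimination (face L Y) := by
  intro X hX X' hX' e he
  rw [mem_face_iff hL.composition hY] at hX hX'
  obtain ⟨Z, hZ, hZe, hZf⟩ := hL.strong_elimination X hX.1 X' hX'.1 e he
  refine ⟨Z, (mem_face_iff hL.composition hY).2 ⟨hZ, fun f => ?_⟩, hZe, hZf⟩
  by_cases hf : Y f = 0
  · exact Or.inl hf
  · right
    have h1 := hX.2.apply_eq hf
    have h2 := hX'.2.apply_eq hf
    rw [hZf f, comp_apply_of_ne_zero (by rwa [h1]), h1]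
    rw [mem_sep_iff, h1, h2]
    exact fun h => sign_ne_neg h.1 h.2

/-- A system with strong elimination that attains all patterns without zeros on a finite set
attains all patterns on it. -/
lemma StrongElimination.exists_eq_on {K : Set (U → SignType)} (hK : StrongElimination K)
    (A : Finset U)
    (h : ∀ W : U → SignType, (∀ e ∈ A, W e ≠ 0) → ∃ Z ∈ K, ∀ e ∈ A, Z e = W e)
    (W : U → SignType) : ∃ Z ∈ K, ∀ e ∈ A, Z e = W e := by
  classical
  induction hn : (A.filter fun e => W e = 0).card generalizing W with
  | zero =>
    rw [Finset.card_eq_zero, Finset.filter_eq_empty_iff] at hn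
    exact h W hn
  | succ n ih =>
    obtain ⟨e, he⟩ := Finset.card_pos.1 (by omega : 0 < (A.filter fun e => W e = 0).card)
    have hupd : ∀ s : SignType, s ≠ 0 →
        (A.filter fun f => Function.update W e s f = 0).card = n := by
      intro s hs
      have : (A.filter fun f => Function.update W e s f = 0) =
          (A.filter fun f => W f = 0).erase e := by
        ext f
        by_cases hf : f = e
        · subst hf; simp [hs]
        · simp [hf]
      rw [this, Finset.card_erase_of_mem he, hn]
      rfl
    rw [Finset.mem_filter] at he
    -- The zero at `e` comes from eliminating `e` between realizations with +1 and −1 there; these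
    -- agree on the rest of `A`, so no other value on `A` changes.
    obtain ⟨X, hX, hXW⟩ := ih _ (hupd 1 (by decide))
    obtain ⟨Y, hY, hYW⟩ := ih _ (hupd (-1) (by decide))
    have hXe : X e = 1 := by rw [hXW e he.1, Function.update_self]
    have hYe : Y e = -1 := by rw [hYW e he.1, Function.update_self]
    obtain ⟨Z, hZ, hZe, hZf⟩ := hK X hX Y hY e (by rw [mem_sep_iff, hXe, hYe]; decide)
    refine ⟨Z, hZ, fun f hf => ?_⟩
    by_cases hfe : f = e
    · rw [hfe, hZe, he.2]
    · have h1 := hXW f hf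
      have h2 := hYW f hf
      rw [Function.update_of_ne hfe] at h1 h2
      rw [hZf f]
      · by_cases h0 : X f = 0
        · rw [comp_apply_of_eq_zero h0, h2]
        · rw [comp_apply_of_ne_zero h0, h1]
      · rw [mem_sep_iff, h1, h2]
        exact fun h => sign_ne_neg h.1 h.2

/-- Every member lies below a member without zeros. -/
def HasFullTopes (K : Set (U → SignType)) : Prop :=
  ∀ X ∈ K, ∃ Z ∈ K, SignLE X Z ∧ ∀ e, Z e ≠ 0

lemma HasFullTopes.isTope_iff {K : Set (U → SignType)} (hK : HasFullTopes K) {T : U → SignType} :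
    IsTope K T ↔ T ∈ K ∧ ∀ e, T e ≠ 0 := by
  constructor
  · rintro ⟨hT, hmax⟩
    obtain ⟨Z, hZ, hTZ, h0⟩ := hK T hT
    exact ⟨hT, hmax Z hZ hTZ ▸ h0⟩
  · rintro ⟨hT, h0⟩
    exact ⟨hT, fun Y _ hTY => funext fun e => hTY.apply_eq (h0 e)⟩

lemma hasFullTopes_of_isSimple [Finite U] {L : Set (U → SignType)} (hL : Composition L)
    (hs : IsSimple L) : HasFullTopes L := by
  classical
  cases nonempty_fintype U
  intro X hX
  have key : ∀ s : Finset U, ∃ Z ∈ L, SignLE X Z ∧ ∀ e ∈ s, Z e ≠ 0 := by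
    intro s
    induction s using Finset.induction_on with
    | empty => exact ⟨X, hX, SignLE.refl X, by simp⟩
    | insert a s _ ih =>
      obtain ⟨Z, hZ, hXZ, h0⟩ := ih
      obtain ⟨V, hV, hVa⟩ := hs.all_signs a 1
      refine ⟨comp Z V, hL Z hZ V hV, hXZ.trans (signLE_comp Z V), fun e he => ?_⟩
      by_cases hZe : Z e = 0
      · rcases Finset.mem_insert.1 he with rfl | he
        · rw [comp_apply_of_eq_zero hZe, hVa]; decide
        · exact absurd hZe (h0 e he)
      · rwa [comp_apply_of_ne_zero hZe]
  obtain ⟨Z, hZ, hXZ, h0⟩ := key Finset.univ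
  exact ⟨Z, hZ, hXZ, fun e => h0 e (Finset.mem_univ e)⟩

lemma HasFullTopes.face {L : Set (U → SignType)} (hL : Composition L) (hfull : HasFullTopes L)
    {Y : U → SignType} (hY : Y ∈ L) : HasFullTopes (face L Y) := by
  intro X hX
  rw [mem_face_iff hL hY] at hX
  obtain ⟨Z, hZ, hXZ, h0⟩ := hfull X hX.1
  exact ⟨Z, (mem_face_iff hL hY).2 ⟨hZ, hX.2.trans hXZ⟩, hXZ, h0⟩

/-- The sign vector without zeros whose positive part is the given set. -/
def signOf [DecidableEq U] (A : Finset U) : U → SignType := fun e => if e ∈ A then 1 else -1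

section SignOf

variable [DecidableEq U]

lemma signOf_ne_zero (A : Finset U) (e : U) : signOf A e ≠ 0 := by
  by_cases h : e ∈ A <;> simp [signOf, h]

lemma signOf_eq_one_iff {A : Finset U} {e : U} : signOf A e = 1 ↔ e ∈ A := by
  by_cases h : e ∈ A <;> simp [signOf, h]

lemma signOf_eq_iff {A B : Finset U} {e : U} : signOf A e = signOf B e ↔ (e ∈ A ↔ e ∈ B) := by
  by_cases h : e ∈ A <;> by_cases h' : e ∈ B <;> simp [signOf, h, h']

lemma signOf_eq_of_ne_zero {T : U → SignType} {A : Finset U} (hA : ∀ e, e ∈ A ↔ T e = 1)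
    (hT : ∀ e, T e ≠ 0) : signOf A = T := by
  funext e
  have h1 := hA e
  have h2 := hT e
  unfold signOf
  generalize T e = t at *
  by_cases h : e ∈ A
  · rw [if_pos h]; exact (h1.1 h).symm
  · rw [if_neg h]
    rw [iff_false_left h] at h1
    revert t; decide

lemma signOf_filter_eq_one [Fintype U] {T : U → SignType} (hT : ∀ e, T e ≠ 0) :
    signOf (Finset.univ.filter fun e => T e = 1) = T :=
  signOf_eq_of_ne_zero (by simp) hT

lemma HasFullTopes.mem_topeFamily_iff [Fintype U] {K : Set (U → SignType)} (hK : HasFullTopes K)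
    {A : Finset U} : A ∈ topeFamily K ↔ signOf A ∈ K := by
  simp only [topeFamily, Finset.mem_filter, Finset.mem_univ, true_and]
  constructor
  · rintro ⟨T, hT, rfl⟩
    rw [hK.isTope_iff] at hT
    rw [signOf_eq_of_ne_zero (by simp) hT.2]
    exact hT.1
  · intro h
    refine ⟨signOf A, hK.isTope_iff.2 ⟨h, signOf_ne_zero A⟩, ?_⟩
    ext e
    simp [signOf_eq_one_iff]

end SignOf

/-! ### Full faces -/

/-- The face of `Y` consists of all sign vectors above `Y`. -/
def IsFullAt (L : Set (U → SignType)) (Y : U → SignType) : Prop := ∀ W, comp Y W ∈ L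

section FullFaces

variable [Fintype U] [DecidableEq U]

/-- The translation of face symmetry into sets: the antipode of a tope within the face of `Y`. -/
lemma signOf_symmDiff_zeros {Y : U → SignType} {A : Finset U} (hA : SignLE Y (signOf A)) :
    signOf (symmDiff A (Finset.univ.filter fun e => Y e = 0)) = comp Y (-signOf A) := by
  funext e
  by_cases h : Y e = 0
  · rw [comp_apply_of_eq_zero h, Pi.neg_apply]
    by_cases he : e ∈ A <;> simp [signOf, Finset.mem_symmDiff, h, he]
  · rw [comp_apply_of_ne_zero h, ← hA.apply_eq h, signOf_eq_iff]
    simp [Finset.mem_symmDiff, h]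

/-- Fullness can be tested on topes, since elimination inside the face supplies all patterns with
zeros. -/
lemma isFullAt_of_forall_signOf {L : Set (U → SignType)} (hL : IsCOM L) {Y : U → SignType}
    (hY : Y ∈ L) (h : ∀ A : Finset U, SignLE Y (signOf A) → signOf A ∈ L) : IsFullAt L Y := by
  intro W
  obtain ⟨Z, hZ, hZW⟩ := (strongElimination_face hL hY).exists_eq_on
    (Finset.univ.filter fun e => Y e = 0) (fun V hV => by
      have h0 : ∀ e, comp Y V e ≠ 0 := fun e => by
        by_cases he : Y e = 0
        · rw [comp_apply_of_eq_zero he]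
          exact hV e (by simpa using he)
        · rwa [comp_apply_of_ne_zero he]
      refine ⟨comp Y V, (mem_face_iff hL.composition hY).2 ⟨?_, signLE_comp Y V⟩, fun e he => ?_⟩
      · rw [← signOf_filter_eq_one h0]
        apply h
        rw [signOf_filter_eq_one h0]
        exact signLE_comp Y V
      · exact comp_apply_of_eq_zero (by simpa using he) V) W
  rw [mem_face_iff hL.composition hY] at hZ
  convert hZ.1 using 1
  funext e
  by_cases he : Y e = 0
  · rw [comp_apply_of_eq_zero he, hZW e (by simpa using he)]
  · rw [comp_apply_of_ne_zero he, hZ.2.apply_eq he]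

lemma mem_topeFamily_face_iff {L : Set (U → SignType)} (hL : Composition L)
    (hfull : HasFullTopes L) {Y : U → SignType} (hY : Y ∈ L) {A : Finset U} :
    A ∈ topeFamily (face L Y) ↔ signOf A ∈ L ∧ SignLE Y (signOf A) := by
  rw [(hfull.face hL hY).mem_topeFamily_iff, mem_face_iff hL hY]

lemma card_subcube_le (Y : U → SignType) (S : Finset (Finset U))
    (hS : ∀ A ∈ S, SignLE Y (signOf A)) :
    S.card ≤ 2 ^ (Finset.univ.filter fun e => Y e = 0).card := by
  rw [← Finset.card_powerset]
  apply Finset.card_le_card_of_injOn (fun A => A ∩ Finset.univ.filter fun e => Y e = 0)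
  · intro A _
    exact Finset.mem_coe.2 (Finset.mem_powerset.2 Finset.inter_subset_right)
  · intro A hA B hB hAB
    ext e
    by_cases he : Y e = 0
    · have := congrArg (fun s => e ∈ s) hAB
      simpa [he] using this
    · rw [← signOf_eq_iff, (hS A hA).apply_eq he, (hS B hB).apply_eq he]

lemma IsFullAt.isHypercube {L : Set (U → SignType)} (hL : Composition L)
    (hfull : HasFullTopes L) {Y : U → SignType} (hY : Y ∈ L) (h : IsFullAt L Y) :
    IsHypercube (topeGraph (face L Y)) := by
  set Z := Finset.univ.filter fun e => Y e = 0 with hZ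
  set P := Finset.univ.filter fun e => Y e = 1 with hP
  let emb : Fin Z.card ↪ U := Z.equivFin.symm.toEmbedding.trans (Function.Embedding.subtype _)
  have hemb : ∀ i, Y (emb i) = 0 := fun i =>
    (Finset.mem_filter.1 (Z.equivFin.symm i).2).2
  have hsurj : ∀ e, Y e = 0 → ∃ i, emb i = e := fun e he =>
    ⟨Z.equivFin ⟨e, by simpa [hZ] using he⟩, by simp [emb]⟩
  have hle : ∀ B : Finset (Fin Z.card), SignLE Y (signOf (B.map emb ∪ P)) := by
    intro B e
    by_cases he : Y e = 0
    · exact Or.inl he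
    · right
      have h1 : e ∉ B.map emb := by
        rw [Finset.mem_map]
        rintro ⟨i, -, rfl⟩
        exact he (hemb i)
      have h2 : e ∈ B.map emb ∪ P ↔ Y e = 1 := by simp [hP, h1, -Finset.mem_map]
      unfold signOf
      generalize Y e = t at *
      by_cases h3 : t = 1
      · rw [if_pos (h2.2 h3), h3]
      · rw [if_neg (fun h4 => h3 (h2.1 h4))]
        clear h2
        revert t; decide
  have hmemP : ∀ i, emb i ∉ P := fun i => by simp [hP, hemb i]
  let f : Finset (Fin Z.card) → (topeFamily (face L Y) : Set (Finset U)) := fun B =>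
    ⟨B.map emb ∪ P, (mem_topeFamily_face_iff hL hfull hY).2
      ⟨by rw [← (hle B).comp_eq]; exact h _, hle B⟩⟩
  have hdiff : ∀ B C : Finset (Fin Z.card),
      symmDiff (B.map emb ∪ P) (C.map emb ∪ P) = (symmDiff B C).map emb := by
    intro B C
    ext e
    by_cases he : ∃ i, emb i = e
    · obtain ⟨i, rfl⟩ := he
      simp only [Finset.mem_symmDiff, Finset.mem_union, Finset.mem_map', hmemP i, or_false]
    · have hm : ∀ D : Finset (Fin Z.card), e ∉ D.map emb := fun D hD =>
        he (by obtain ⟨i, -, hi⟩ := Finset.mem_map.1 hD; exact ⟨i, hi⟩)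
      simp only [Finset.mem_symmDiff, Finset.mem_union, hm, false_or]
      tauto
  have hbij : Function.Bijective f := by
    constructor
    · intro B C hBC
      have h1 : B.map emb ∪ P = C.map emb ∪ P := congrArg Subtype.val hBC
      have h2 := hdiff B C
      rw [h1, symmDiff_self, eq_comm, Finset.bot_eq_empty, Finset.map_eq_empty] at h2
      exact symmDiff_eq_bot.1 h2
    · rintro ⟨A, hA⟩
      have hA' := ((mem_topeFamily_face_iff hL hfull hY).1 hA).2
      refine ⟨Finset.univ.filter fun i => emb i ∈ A, Subtype.ext ?_⟩
      change (Finset.univ.filter fun i => emb i ∈ A).map emb ∪ P = A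
      ext e
      by_cases he : Y e = 0
      · obtain ⟨i, rfl⟩ := hsurj e he
        simp only [Finset.mem_union, Finset.mem_map', hmemP i, or_false, Finset.mem_filter,
          Finset.mem_univ, true_and]
      · rw [← signOf_eq_iff, hA'.apply_eq he, (hle _).apply_eq he]
  refine ⟨Z.card, ⟨RelIso.symm ⟨Equiv.ofBijective f hbij, ?_⟩⟩⟩
  intro B C
  change (symmDiff (B.map emb ∪ P) (C.map emb ∪ P)).card = 1 ↔ (symmDiff B C).card = 1
  rw [hdiff, Finset.card_map]

lemma isFullAt_of_isHypercube {L : Set (U → SignType)} (hL : IsCOM L)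
    (hfull : HasFullTopes L) {Y : U → SignType} (hY : Y ∈ L)
    (h : IsHypercube (topeGraph (face L Y))) : IsFullAt L Y := by
  obtain ⟨n, ⟨φ⟩⟩ := h
  set Z := Finset.univ.filter fun e => Y e = 0 with hZ
  set S := topeFamily (face L Y) with hS
  have hmem : ∀ A, A ∈ S ↔ signOf A ∈ L ∧ SignLE Y (signOf A) := fun A =>
    mem_topeFamily_face_iff hL.composition hfull hY
  have hcard : S.card = 2 ^ n := by
    have h1 := Nat.card_congr φ.toEquiv
    rw [Nat.card_coe_set_eq, Set.ncard_coe_finset] at h1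
    rw [h1]
    simp
  have hZn : Z.card ≤ n := by
    obtain ⟨T, hT, hYT, hT0⟩ := hfull Y hY
    have hTA := signOf_filter_eq_one hT0
    set A := Finset.univ.filter fun e => T e = 1
    have hA : A ∈ S := (hmem A).2 ⟨by rwa [hTA], by rwa [hTA]⟩
    have hA' : symmDiff A Z ∈ S := by
      rw [hmem, hZ, signOf_symmDiff_zeros ((hmem A).1 hA).2, hTA]
      exact ⟨hL.face_symmetry Y hY T hT, signLE_comp _ _⟩
    -- This walk has length at most `n`; pulled back along `φ.symm` it joins antipodal topes, which
    -- differ in |Z| places.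
    obtain ⟨p, hp⟩ := exists_walk_hypercube (φ ⟨A, hA⟩) (φ ⟨symmDiff A Z, hA'⟩)
    have h1 := card_symmDiff_le_length (φ := fun v => (φ.symm v).1)
      (fun v w hvw => le_of_eq (φ.symm.map_rel_iff.2 hvw)) p
    simp only [RelIso.symm_apply_apply, symmDiff_symmDiff_cancel_left] at h1
    have h2 := (symmDiff (φ ⟨A, hA⟩) (φ ⟨symmDiff A Z, hA'⟩)).card_le_univ
    rw [Fintype.card_fin] at h2
    omega
  refine isFullAt_of_forall_signOf hL hY fun A hA => ?_
  have hsub : S ⊆ insert A S := Finset.subset_insert A S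
  have hle := card_subcube_le Y (insert A S) fun B hB => by
    rcases Finset.mem_insert.1 hB with rfl | hB
    · exact hA
    · exact ((hmem B).1 hB).2
  have heq := Finset.eq_of_subset_of_card_le hsub
    (hle.trans ((Nat.pow_le_pow_right (by norm_num) hZn).trans hcard.ge))
  have : A ∈ S := heq ▸ Finset.mem_insert_self A S
  exact ((hmem A).1 this).1

end FullFaces

/-! ### Half-carriers -/

/-- The half-carrier of `e` on the side of the sign `s`. -/
def halfCarrier (L : Set (U → SignType)) (e : U) (s : SignType) : Set (U → SignType) :=
  {Y | Y ∈ L ∧ Y e = s} ∩ carrier L e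

lemma mem_halfCarrier_iff {L : Set (U → SignType)} (hL : Composition L) {e : U} {s : SignType}
    {Y : U → SignType} :
    Y ∈ halfCarrier L e s ↔ Y ∈ L ∧ Y e = s ∧ ∃ X ∈ L, X e = 0 ∧ SignLE X Y := by
  constructor
  · rintro ⟨⟨hY, hYe⟩, X, hX, hXe, h⟩
    exact ⟨hY, hYe, X, hX, hXe, ((mem_face_iff hL hX).1 h).2⟩
  · rintro ⟨hY, hYe, X, hX, hXe, h⟩
    exact ⟨⟨hY, hYe⟩, X, hX, hXe, (mem_face_iff hL hX).2 ⟨hY, h⟩⟩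

lemma halfCarrier_of_signLE {L : Set (U → SignType)} (hL : Composition L) {e : U} {s : SignType}
    (hs : s ≠ 0) {Y Z : U → SignType} (hY : Y ∈ halfCarrier L e s) (hZ : Z ∈ L)
    (hYZ : SignLE Y Z) : Z ∈ halfCarrier L e s := by
  rw [mem_halfCarrier_iff hL] at hY ⊢
  obtain ⟨-, hYe, X, hX, hXe, hXY⟩ := hY
  exact ⟨hZ, by rw [hYZ.apply_eq (by rwa [hYe]), hYe], X, hX, hXe, hXY.trans hYZ⟩

lemma HasFullTopes.halfCarrier {L : Set (U → SignType)} (hL : Composition L)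
    (hfull : HasFullTopes L) {e : U} {s : SignType} (hs : s ≠ 0) :
    HasFullTopes (halfCarrier L e s) := by
  intro Y hY
  obtain ⟨Z, hZ, hYZ, h0⟩ := hfull Y ((mem_halfCarrier_iff hL).1 hY).1
  exact ⟨Z, halfCarrier_of_signLE hL hs hY hZ hYZ, hYZ, h0⟩

lemma comp_apply_eq_of_signLE_right {X Y Q : U → SignType} {f : U} (hQ : SignLE Q Y)
    (hf : f ∉ sep X Y) (h0 : Q f ≠ 0) : comp X Y f = Q f := by
  have h1 := hQ.apply_eq h0
  by_cases hX : X f = 0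
  · rw [comp_apply_of_eq_zero hX, h1]
  · rw [comp_apply_of_ne_zero hX]
    have h2 : Y f ≠ 0 := by rwa [h1]
    rcases sign_eq_or_eq_neg h2 hX with h | h
    · rw [← h, h1]
    · exact absurd (mem_sep_iff.2 ⟨hX, h⟩) hf

/-- Eliminating in L gives a Z with the right sign at `e`, but possibly above no covector vanishing
at `e`. Replacing it by R∘Z repairs this, provided R vanishes at `e` and `g` and conforms to X∘Y off
the separator. -/
lemma strongElimination_halfCarrier {L : Set (U → SignType)} (hL : IsCOM L) {e : U}
    {s : SignType} (hs : s ≠ 0) : StrongElimination (halfCarrier L e s) := by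
  have hC := hL.composition
  intro X hX Y hY g hg
  rw [mem_halfCarrier_iff hC] at hX hY
  obtain ⟨hX, hXe, P, hP, hPe, hPX⟩ := hX
  obtain ⟨hY, hYe, Q, hQ, hQe, hQY⟩ := hY
  have hg' := mem_sep_iff.1 hg
  -- R is P or Q if one of them vanishes at `g`; otherwise both have the signs of X and Y there, and
  -- R comes from eliminating `g` between P and Q.
  obtain ⟨R, hR, hRg, hRe, hRf⟩ : ∃ R ∈ L, R g = 0 ∧ R e = 0 ∧
      ∀ f, f ∉ sep X Y → R f = 0 ∨ R f = comp X Y f := by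
    by_cases hPg : P g = 0
    · refine ⟨P, hP, hPg, hPe, fun f _ => ?_⟩
      by_cases h0 : P f = 0
      · exact Or.inl h0
      · right
        rw [comp_apply_of_ne_zero (hPX.apply_ne_zero h0), hPX.apply_eq h0]
    by_cases hQg : Q g = 0
    · refine ⟨Q, hQ, hQg, hQe, fun f hf => ?_⟩
      by_cases h0 : Q f = 0
      · exact Or.inl h0
      · exact Or.inr (comp_apply_eq_of_signLE_right hQY hf h0).symm
    · have hsub : ∀ f, f ∈ sep P Q → f ∈ sep X Y := by
        intro f hf
        rw [mem_sep_iff] at hf ⊢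
        have h1 : Q f ≠ 0 := by
          rw [hf.2]; simpa using hf.1
        rw [hPX.apply_eq hf.1, hQY.apply_eq h1]
        exact hf
      have hgPQ : g ∈ sep P Q := by
        rw [mem_sep_iff, ← hPX.apply_eq hPg, ← hQY.apply_eq hQg]
        exact hg'
      obtain ⟨R, hR, hRg, hRf⟩ := hL.strong_elimination P hP Q hQ g hgPQ
      refine ⟨R, hR, hRg, ?_, fun f hf => ?_⟩
      · rw [hRf e (by simp [mem_sep_iff, hPe]), comp_apply_of_eq_zero hPe, hQe]
      · rw [hRf f (fun h => hf (hsub f h))]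
        by_cases h0 : P f = 0
        · rw [comp_apply_of_eq_zero h0]
          by_cases h1 : Q f = 0
          · exact Or.inl h1
          · exact Or.inr (comp_apply_eq_of_signLE_right hQY hf h1).symm
        · rw [comp_apply_of_ne_zero h0, comp_apply_of_ne_zero (hPX.apply_ne_zero h0),
            hPX.apply_eq h0]
          exact Or.inr rfl
  obtain ⟨Z, hZ, hZg, hZf⟩ := hL.strong_elimination X hX Y hY g hg
  have hesep : e ∉ sep X Y := by
    rw [mem_sep_iff, hXe, hYe]
    exact fun h => sign_ne_neg h.1 h.2
  refine ⟨comp R Z, (mem_halfCarrier_iff hC).2 ⟨hC R hR Z hZ, ?_, R, hR, hRe, signLE_comp R Z⟩,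
    ?_, fun f hf => ?_⟩
  · rw [comp_apply_of_eq_zero hRe, hZf e hesep, comp_apply_of_ne_zero (by rwa [hXe]), hXe]
  · rw [comp_apply_of_eq_zero hRg, hZg]
  · by_cases h0 : R f = 0
    · rw [comp_apply_of_eq_zero h0, hZf f hf]
    · rw [comp_apply_of_ne_zero h0]
      exact (hRf f hf).resolve_left h0

section Carriers

variable [Fintype U] [DecidableEq U]

/-- If the faces of the covectors strictly above another covector are full, then the tope
families of the half-carriers are ample. -/
lemma isAmple_halfCarrier {L : Set (U → SignType)} (hL : IsCOM L) (hfull : HasFullTopes L)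
    (h : ∀ X ∈ L, ∀ Y ∈ L, SignLE X Y → X ≠ Y → IsFullAt L Y) {e : U} {s : SignType}
    (hs : s ≠ 0) : IsAmple (topeFamily (halfCarrier L e s)) := by
  have hC := hL.composition
  have hmem : ∀ A, A ∈ topeFamily (halfCarrier L e s) ↔ signOf A ∈ halfCarrier L e s :=
    fun A => (hfull.halfCarrier hC hs).mem_topeFamily_iff
  refine isAmple_of_forall_exists_cube fun A hA => ?_
  rw [shatters_iff_forall_exists] at hA
  obtain ⟨Z, hZ, hZA⟩ := (strongElimination_halfCarrier hL hs).exists_eq_on A (fun W hW => by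
    obtain ⟨B, hB, hBA⟩ := hA (Finset.univ.filter fun f => W f = 1)
    refine ⟨signOf B, (hmem B).1 hB, fun f hf => ?_⟩
    have h1 := hBA f hf
    have h2 := hW f hf
    rw [Finset.mem_filter, and_iff_right (Finset.mem_univ f)] at h1
    unfold signOf
    generalize W f = t at *
    by_cases h3 : f ∈ B
    · rw [if_pos h3, h1.1 h3]
    · rw [if_neg h3]
      rw [iff_false_left h3] at h1
      revert t; decide) 0
  obtain ⟨hZL, hZe, R, hR, hRe, hRZ⟩ := (mem_halfCarrier_iff hC).1 hZ
  -- Z vanishes on `A` and is strictly above R, since they differ at `e`. Its full face therefore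
  -- contains every modification on `A` of a tope above Z.
  have hZfull := h R hR Z hZL hRZ fun hRZ' => hs (by rw [← hZe, ← hRZ', hRe])
  obtain ⟨T, -, hZT, hT0⟩ := hfull Z hZL
  have hT := signOf_filter_eq_one hT0
  set B := Finset.univ.filter fun f => T f = 1
  refine ⟨B, fun C hCB => (hmem C).2 ?_⟩
  have hle : SignLE Z (signOf C) := fun f => by
    by_cases h0 : Z f = 0
    · exact Or.inl h0
    · right
      have hfA : f ∉ A := fun hf => h0 (by rw [hZA f hf]; rfl)
      rw [signOf_eq_iff.2 (hCB f hfA), hT, hZT.apply_eq h0]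
  refine halfCarrier_of_signLE hC hs hZ ?_ hle
  rw [← hle.comp_eq]
  exact hZfull _

/-- Faces inside a half-carrier with ample tope family are full. -/
lemma isFullAt_of_isAmple_halfCarrier {L : Set (U → SignType)} (hL : IsCOM L)
    (hfull : HasFullTopes L) {e : U} {s : SignType} (hs : s ≠ 0)
    (h : IsAmple (topeFamily (halfCarrier L e s))) {Y : U → SignType}
    (hY : Y ∈ halfCarrier L e s) : IsFullAt L Y := by
  have hC := hL.composition
  have hYL := ((mem_halfCarrier_iff hC).1 hY).1
  obtain ⟨T, hT, hYT, hT0⟩ := hfull Y hYL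
  have hTA := signOf_filter_eq_one hT0
  set P := Finset.univ.filter fun f => T f = 1
  set Z := Finset.univ.filter fun f => Y f = 0 with hZdef
  -- Freezing the support of Y cuts out exactly the topes of its face, all of which stay in the
  -- half-carrier.
  obtain ⟨S, hS, hSample⟩ := h.exists_subcube P Zᶜ
  have hmem : ∀ A, A ∈ S ↔ signOf A ∈ L ∧ SignLE Y (signOf A) := by
    intro A
    have h1 : (∀ x ∈ Zᶜ, x ∈ A ↔ x ∈ P) ↔ SignLE Y (signOf A) := by
      refine forall_congr' fun x => ?_
      by_cases hx : Y x = 0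
      · simp [hZdef, hx]
      · rw [← signOf_eq_iff, hTA, hYT.apply_eq hx]
        simp [hZdef, hx, eq_comm]
    rw [hS, h1, (hfull.halfCarrier hC hs).mem_topeFamily_iff]
    constructor
    · rintro ⟨h2, h3⟩
      exact ⟨((mem_halfCarrier_iff hC).1 h2).1, h3⟩
    · rintro ⟨h2, h3⟩
      exact ⟨halfCarrier_of_signLE hC hs hY h2 h3, h3⟩
  have hsh := hSample.shatters_of_antipodal
    ⟨P, (hmem P).2 ⟨by rwa [hTA], by rwa [hTA]⟩⟩ (Z := Z) fun B hB => by
      rw [hmem] at hB ⊢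
      rw [hZdef, signOf_symmDiff_zeros hB.2]
      exact ⟨hL.face_symmetry Y hYL _ hB.1, signLE_comp _ _⟩
  refine isFullAt_of_forall_signOf hL hYL fun A hA => ?_
  obtain ⟨B, hB, hBA⟩ := shatters_iff_forall_exists.1 hsh A
  rw [hmem] at hB
  have : B = A := by
    ext x
    by_cases hx : Y x = 0
    · exact hBA x (by simpa [hZdef] using hx)
    · rw [← signOf_eq_iff, hB.2.apply_eq hx, hA.apply_eq hx]
  exact this ▸ hB.1

end Carriers

/-! ### Uniform oriented matroids -/

section Uniform

variable [Fintype U]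

lemma mem_support_iff {X : U → SignType} {e : U} : e ∈ support X ↔ X e ≠ 0 := by
  simp [support]

lemma support_nonempty {X : U → SignType} (hX : X ≠ 0) : (support X).Nonempty := by
  obtain ⟨e, he⟩ := Function.ne_iff.1 hX
  exact ⟨e, mem_support_iff.2 he⟩

lemma support_neg (X : U → SignType) : support (-X) = support X := by
  ext e
  simp [mem_support_iff]

lemma SignLE.support_subset {X Y : U → SignType} (h : SignLE X Y) : support X ⊆ support Y :=
  fun e he => by
    rw [mem_support_iff] at he ⊢
    exact h.apply_ne_zero he

lemma SignLE.eq_of_support_subset {X Y : U → SignType} (h : SignLE X Y)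
    (hs : support Y ⊆ support X) : X = Y := by
  funext e
  by_cases he : X e = 0
  · rw [he]
    by_contra hY
    exact mem_support_iff.1 (hs (mem_support_iff.2 (Ne.symm hY))) he
  · exact (h.apply_eq he).symm

lemma exists_cocircuit_signLE {M : Set (U → SignType)} {Y : U → SignType} (hY : Y ∈ M)
    (h0 : Y ≠ 0) : ∃ C ∈ cocircuits M, SignLE C Y := by
  induction hn : (support Y).card using Nat.strong_induction_on generalizing Y with
  | _ n ih =>
    by_cases h : ∀ Z ∈ M, Z ≠ 0 → SignLE Z Y → Z = Y
    · exact ⟨Y, ⟨hY, h0, h⟩, SignLE.refl Y⟩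
    · push Not at h
      obtain ⟨Z, hZ, hZ0, hZY, hne⟩ := h
      have hlt : (support Z).card < n := by
        rw [← hn]
        refine Finset.card_lt_card ⟨hZY.support_subset, fun hs => hne ?_⟩
        exact hZY.eq_of_support_subset hs
      obtain ⟨C, hC, hCZ⟩ := ih _ hlt hZ hZ0 rfl
      exact ⟨C, hC, hCZ.trans hZY⟩

/-- In a uniform oriented matroid the faces of nonzero covectors are full. -/
lemma IsUOMOfRank.isFullAt {r : ℕ} {M : Set (U → SignType)} (hM : IsUOMOfRank r M)
    {Y : U → SignType} (hY : Y ∈ M) (h0 : Y ≠ 0) : IsFullAt M Y := by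
  classical
  obtain ⟨C, hC, hCY⟩ := exists_cocircuit_signLE hY h0
  have hcard := hM.card_support C hC
  have hle := Finset.card_le_card hCY.support_subset
  have hr := hM.rank_le
  have hsingle : ∀ (a : U) (s : SignType), Y a = 0 → s ≠ 0 →
      ∃ X ∈ M, X a = s ∧ ∀ f, Y f = 0 → f ≠ a → X f = 0 := by
    intro a s ha hs
    have hins : (insert a (support Y)).card = (support Y).card + 1 :=
      Finset.card_insert_of_notMem (by simp [mem_support_iff, ha])
    -- The size |U|+1−r is at least 1 because r ≤ |U|, and it fits because the support of Y contains
    -- that of the cocircuit C.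
    obtain ⟨A, haA, hAY, hA⟩ := Finset.exists_subsuperset_card_eq
      (Finset.singleton_subset_iff.2 (Finset.mem_insert_self a (support Y)))
      (by rw [Finset.card_singleton]; omega : _ ≤ Fintype.card U + 1 - r) (by omega)
    obtain ⟨X, hXA, hX⟩ := hM.two_signings A (by omega)
    have hXM : X ∈ M := by
      have : X ∈ ({X, -X} : Set (U → SignType)) := Set.mem_insert _ _
      rw [← hX] at this
      exact this.1.1
    have hXa : X a ≠ 0 := by
      rw [← mem_support_iff, hXA]
      exact Finset.singleton_subset_iff.1 haA
    have hXf : ∀ f, Y f = 0 → f ≠ a → X f = 0 := by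
      intro f hf hfa
      by_contra h
      rw [← ne_eq, ← mem_support_iff, hXA] at h
      rcases Finset.mem_insert.1 (hAY h) with h | h
      · exact hfa h
      · exact mem_support_iff.1 h hf
    rcases sign_eq_or_eq_neg hXa hs with h | h
    · exact ⟨X, hXM, h, hXf⟩
    · exact ⟨-X, hM.isOM.symmetry X hXM, by simp [h], fun f hf hfa => by simp [hXf f hf hfa]⟩
  intro W
  have key : ∀ t : Finset U, comp Y (fun f => if f ∈ t then W f else 0) ∈ M := by
    intro t
    induction t using Finset.induction_on with
    | empty =>
      convert hY using 1
      funext f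
      by_cases hf : Y f = 0 <;> simp [comp, hf]
    | insert a t hat ih =>
      by_cases h : Y a = 0 ∧ W a ≠ 0
      · obtain ⟨X, hX, hXa, hXf⟩ := hsingle a (W a) h.1 h.2
        convert hM.isOM.composition _ ih X hX using 1
        rw [comp_assoc]
        funext f
        by_cases hf : Y f = 0
        · by_cases hfa : f = a
          · subst hfa
            simp [comp, hf, hat, hXa]
          · simp only [comp, if_pos hf, Finset.mem_insert, hfa, false_or, hXf f hf hfa]
            by_cases h2 : (if f ∈ t then W f else 0) = 0
            · rw [if_pos h2, h2]
            · rw [if_neg h2]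
        · rw [comp_apply_of_ne_zero hf, comp_apply_of_ne_zero hf]
      · convert ih using 1
        funext f
        by_cases hf : Y f = 0
        · rw [comp_apply_of_eq_zero hf, comp_apply_of_eq_zero hf]
          by_cases hfa : f = a
          · subst hfa
            have : W f = 0 := by
              by_contra h2
              exact h ⟨hf, h2⟩
            simp [this]
          · simp [hfa]
        · rw [comp_apply_of_ne_zero hf, comp_apply_of_ne_zero hf]
  convert key Finset.univ using 2
  simp

/-- Covectors supported on the support of a cocircuit are signings of this cocircuit. -/
lemma eq_or_eq_neg_of_support_subset {M : Set (U → SignType)} (hM : StrongElimination M)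
    {Y W : U → SignType} (hY : Y ∈ cocircuits M) (hW : W ∈ M) (hW0 : W ≠ 0)
    (hWY : support W ⊆ support Y) : W = Y ∨ W = -Y := by
  classical
  induction hn : (Finset.univ.filter fun e => e ∈ sep Y W).card using Nat.strong_induction_on
    generalizing W with
  | _ n ih =>
    by_contra! hne
    have hYW : ∀ f, Y f = 0 → W f = 0 := fun f hf => by
      by_contra h
      exact mem_support_iff.1 (hWY (mem_support_iff.2 h)) hf
    by_cases hsep : ∃ e, e ∈ sep Y W
    · obtain ⟨e, he⟩ := hsep
      -- Z equals Y on the support of Y outside the separator of Y and W, so its own separator from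
      -- Y is smaller: `e` leaves and nothing enters. Z = 0 would force W = −Y, while Z = ±Y is
      -- impossible because Z vanishes at `e`.
      obtain ⟨Z, hZ, hZe, hZf⟩ := hM Y hY.1 W hW e he
      have hYe := (mem_sep_iff.1 he).1
      have hZY : support Z ⊆ support Y := by
        intro f hf
        rw [mem_support_iff] at hf ⊢
        intro h0
        apply hf
        rw [hZf f (by simp [mem_sep_iff, h0]), comp_apply_of_eq_zero h0, hYW f h0]
      have hZ0 : Z ≠ 0 := by
        rintro rfl
        apply hne.2
        funext f
        by_cases h0 : Y f = 0
        · rw [hYW f h0, Pi.neg_apply, h0]; rfl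
        · by_contra h
          have h1 := hZf f (fun h2 => h (mem_sep_iff.1 h2).2)
          rw [comp_apply_of_ne_zero h0] at h1
          exact h0 h1.symm
      have hlt : (Finset.univ.filter fun e => e ∈ sep Y Z).card < n := by
        rw [← hn]
        apply Finset.card_lt_card
        rw [Finset.ssubset_iff_of_subset]
        · refine ⟨e, by simpa using he, ?_⟩
          simp only [Finset.mem_filter, Finset.mem_univ, true_and, mem_sep_iff, hZe]
          rintro ⟨h1, h2⟩
          revert h1 h2
          generalize Y e = t
          revert t; decide
        · intro f hf
          simp only [Finset.mem_filter, Finset.mem_univ, true_and] at hf ⊢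
          by_contra h
          rw [mem_sep_iff] at hf
          have h1 := hZf f h
          rw [comp_apply_of_ne_zero hf.1] at h1
          exact sign_ne_neg hf.1 (h1.symm.trans hf.2)
      rcases ih _ hlt hZ hZ0 hZY rfl with h | h
      · exact hYe (by rw [← h, hZe])
      · have := congrFun h e
        rw [hZe, Pi.neg_apply] at this
        revert hYe this
        generalize Y e = t
        revert t; decide
    · push Not at hsep
      refine hne.1 (hY.2.2 W hW hW0 fun f => ?_)
      by_cases h0 : W f = 0
      · exact Or.inl h0
      · right
        have hYf : Y f ≠ 0 := fun h => h0 (hYW f h)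
        rcases sign_eq_or_eq_neg h0 hYf with h | h
        · exact h
        · exact absurd (mem_sep_iff.2 ⟨hYf, h⟩) (hsep f)

/-- Exchange for covectors of minimal support. -/
lemma exists_support_eq_exchange [DecidableEq U] {M : Set (U → SignType)} (hM : IsOM M)
    (hfull : ∀ Y ∈ M, Y ≠ 0 → IsFullAt M Y) {k : ℕ}
    (hk : ∀ Y ∈ M, Y ≠ 0 → k ≤ (support Y).card) {Z : U → SignType} (hZ : Z ∈ M)
    (hZk : (support Z).card = k) {e g : U} (he : e ∉ support Z) (hg : g ∈ support Z) :
    ∃ V ∈ M, support V = insert e ((support Z).erase g) := by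
  have he0 : Z e = 0 := by
    by_contra h
    exact he (mem_support_iff.2 h)
  have hg0 := mem_support_iff.1 hg
  have hZ0 : Z ≠ 0 := fun h => hg0 (congrFun h g)
  have hP := hfull Z hZ hZ0 (Pi.single e 1)
  have hng0 : (-Z) g ≠ 0 := by rw [Pi.neg_apply]; simpa using hg0
  have hQ := hfull (-Z) (hM.symmetry Z hZ) (fun h => hng0 (congrFun h g)) (Pi.single e 1)
  have hne0 : (-Z) e = 0 := by rw [Pi.neg_apply, he0]; rfl
  -- Z and −Z, both extended by +1 at `e`, are opposite at `g` but agree at `e`. Eliminating `g`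
  -- leaves a support inside the exchanged set, and minimality of `k` gives equality.
  obtain ⟨V, hV, hVg, hVf⟩ := hM.strong_elimination _ hP _ hQ g (by
    rw [mem_sep_iff, comp_apply_of_ne_zero hg0, comp_apply_of_ne_zero hng0]
    exact ⟨hg0, rfl⟩)
  have hVe : V e ≠ 0 := by
    rw [hVf e]
    · rw [comp_apply_of_ne_zero] <;> rw [comp_apply_of_eq_zero he0, Pi.single_eq_same] <;> decide
    · rw [mem_sep_iff, comp_apply_of_eq_zero he0, comp_apply_of_eq_zero hne0, Pi.single_eq_same]
      decide
  refine ⟨V, hV, Finset.eq_of_subset_of_card_le ?_ ?_⟩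
  · intro f hf
    rw [mem_support_iff] at hf
    by_cases hfe : f = e
    · exact hfe ▸ Finset.mem_insert_self _ _
    refine Finset.mem_insert_of_mem (Finset.mem_erase.2 ⟨fun h => hf (h ▸ hVg), ?_⟩)
    rw [mem_support_iff]
    intro h0
    apply hf
    have h1 : (-Z) f = 0 := by rw [Pi.neg_apply, h0]; rfl
    have h2 : (Pi.single e 1 : U → SignType) f = 0 := Pi.single_eq_of_ne hfe 1
    rw [hVf f (by rw [mem_sep_iff, comp_apply_of_eq_zero h0, h2]; simp),
      comp_apply_of_eq_zero (by rw [comp_apply_of_eq_zero h0, h2]), comp_apply_of_eq_zero h1, h2]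
  · have h1 := hk V hV fun h => hVe (congrFun h e)
    rw [Finset.card_insert_of_notMem (fun h => he (Finset.mem_of_mem_erase h)),
      Finset.card_erase_of_mem hg, hZk]
    have := Finset.card_pos.2 ⟨g, hg⟩
    omega

/-- All sets of the minimal size of a support are supports. -/
lemma exists_support_eq [DecidableEq U] {M : Set (U → SignType)} (hM : IsOM M)
    (hfull : ∀ Y ∈ M, Y ≠ 0 → IsFullAt M Y) {k : ℕ}
    (hk : ∀ Y ∈ M, Y ≠ 0 → k ≤ (support Y).card) {A : Finset U} (hA : A.card = k)
    {Z : U → SignType} (hZ : Z ∈ M) (hZk : (support Z).card = k) :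
    ∃ V ∈ M, support V = A := by
  induction hn : (A \ support Z).card generalizing Z with
  | zero =>
    rw [Finset.card_eq_zero, Finset.sdiff_eq_empty_iff_subset] at hn
    exact ⟨Z, hZ, (Finset.eq_of_subset_of_card_le hn (by omega)).symm⟩
  | succ n ih =>
    obtain ⟨e, he⟩ := Finset.card_pos.1 (by omega : 0 < (A \ support Z).card)
    obtain ⟨g, hg⟩ := Finset.card_pos.1 (by
      rw [← Finset.card_sdiff_comm (hA.trans hZk.symm)]; omega : 0 < (support Z \ A).card)
    rw [Finset.mem_sdiff] at he hg
    obtain ⟨V, hV, hVs⟩ := exists_support_eq_exchange hM hfull hk hZ hZk he.2 hg.1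
    refine ih hV ?_ ?_
    · rw [hVs, Finset.card_insert_of_notMem (fun h => he.2 (Finset.mem_of_mem_erase h)),
        Finset.card_erase_of_mem hg.1, hZk]
      have := Finset.card_pos.2 ⟨g, hg.1⟩
      omega
    · have : A \ support V = (A \ support Z).erase e := by
        ext f
        rw [hVs]
        simp only [Finset.mem_sdiff, Finset.mem_insert, Finset.mem_erase]
        by_cases hfg : f = g
        · subst hfg; tauto
        · tauto
      rw [this, Finset.card_erase_of_mem (Finset.mem_sdiff.2 he), hn]
      rfl

/-- A simple oriented matroid in which the faces of all nonzero covectors are full is uniform. -/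
lemma isUOM_of_isFullAt {M : Set (U → SignType)} (hM : IsOM M) (hs : IsSimple M)
    (hfull : ∀ Y ∈ M, Y ≠ 0 → IsFullAt M Y) : IsUOM M := by
  classical
  rcases isEmpty_or_nonempty U with hU | ⟨⟨e⟩⟩
  -- On the empty set, rank 0 asks for signings of sets of size 1, of which there are none.
  · refine ⟨0, hM, hs, Nat.zero_le _, fun X hX => absurd (Subsingleton.elim X 0) hX.2.1,
      fun A hA => ?_⟩
    have : A.card = 0 := by simp [Finset.eq_empty_of_isEmpty A]
    rw [Fintype.card_eq_zero] at hA
    omega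
  have hne : {Y | Y ∈ M ∧ Y ≠ 0}.Nonempty := by
    obtain ⟨Y, hY, hYe⟩ := hs.all_signs e 1
    exact ⟨Y, hY, fun h => by
      rw [h] at hYe
      exact (by decide : (0 : SignType) ≠ 1) hYe⟩
  obtain ⟨Z, ⟨hZ, hZ0⟩, hmin⟩ :=
    Set.exists_min_image _ (fun Y => (support Y).card) (Set.toFinite _) hne
  set k := (support Z).card with hkdef
  have hk : ∀ Y ∈ M, Y ≠ 0 → k ≤ (support Y).card := fun Y hY h0 => hmin Y ⟨hY, h0⟩
  have hkpos : 0 < k := Finset.card_pos.2 (support_nonempty hZ0)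
  have hkle : k ≤ Fintype.card U := Finset.card_le_univ _
  have hcoc : ∀ Y ∈ M, (support Y).card = k → Y ∈ cocircuits M := by
    intro Y hY hYk
    refine ⟨hY, ?_, fun W hW hW0 hWY => hWY.eq_of_support_subset ?_⟩
    · rintro rfl
      have : support (0 : U → SignType) = ∅ := by simp [support]
      rw [this, Finset.card_empty] at hYk
      omega
    · rw [Finset.eq_of_subset_of_card_le hWY.support_subset (by rw [hYk]; exact hk W hW hW0)]
  -- The rank is chosen so that m−r+1 = k. A cocircuit X contains a k-set, which is the support of
  -- some covector V; then V = ±X, so X has size k too.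
  refine ⟨Fintype.card U + 1 - k, hM, hs, by omega, fun X hX => ?_, fun A hA => ?_⟩
  · obtain ⟨A, hAX, hA⟩ := Finset.exists_subset_card_eq (hk X hX.1 hX.2.1)
    obtain ⟨V, hV, rfl⟩ := exists_support_eq hM hfull hk hA hZ rfl
    have hXV : support X = support V := by
      rcases eq_or_eq_neg_of_support_subset hM.strong_elimination hX hV (hcoc V hV hA).2.1 hAX
        with h | h
      · rw [h]
      · rw [h, support_neg]
    rw [hXV, hA]
    omega
  · have hAk : A.card = k := by omega
    obtain ⟨V, hV, rfl⟩ := exists_support_eq hM hfull hk hAk hZ rfl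
    refine ⟨V, rfl, ?_⟩
    ext Y
    simp only [Set.mem_ofPred_eq, Set.mem_insert_iff, Set.mem_singleton_iff]
    constructor
    · rintro ⟨hY, hYV⟩
      exact eq_or_eq_neg_of_support_subset hM.strong_elimination (hcoc V hV hAk) hY.1 hY.2.1
        hYV.subset
    · rintro (rfl | rfl)
      · exact ⟨hcoc _ hV hAk, rfl⟩
      · exact ⟨hcoc _ (hM.symmetry V hV) (by rw [support_neg, hAk]), support_neg V⟩

end Uniform

/-! ### Faces as oriented matroids -/

/-- The extension of a sign vector on the zero set of `X` by the values of `X`. -/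
def extendBy (X : U → SignType) (W : {e // X e = 0} → SignType) : U → SignType :=
  fun e => if h : X e = 0 then W ⟨e, h⟩ else X e

lemma extendBy_apply {X : U → SignType} (W : {e // X e = 0} → SignType) (e : {e // X e = 0}) :
    extendBy X W e = W e := by simp [extendBy, e.2]

lemma signLE_extendBy (X : U → SignType) (W : {e // X e = 0} → SignType) :
    SignLE X (extendBy X W) := fun e => by
  by_cases h : X e = 0 <;> simp [extendBy, h]

lemma SignLE.extendBy_restrict {X Z : U → SignType} (h : SignLE X Z) :
    extendBy X (fun e => Z e.1) = Z := by
  funext e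
  rcases h e with h | h
  · simp [extendBy, h]
  · simp [extendBy, h]

lemma mem_faceSystem_iff {L : Set (U → SignType)} (hL : Composition L) {X : U → SignType}
    (hX : X ∈ L) {W : {e // X e = 0} → SignType} : W ∈ faceSystem L X ↔ extendBy X W ∈ L := by
  constructor
  · rintro ⟨Y, hY, rfl⟩
    rw [mem_face_iff hL hX] at hY
    rw [hY.2.extendBy_restrict]
    exact hY.1
  · intro h
    exact ⟨_, (mem_face_iff hL hX).2 ⟨h, signLE_extendBy X W⟩,
      funext fun e => (extendBy_apply W e).symm⟩

lemma extendBy_comp (X : U → SignType) (W : {e // X e = 0} → SignType) (V : U → SignType) :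
    extendBy X (comp W fun e => V e.1) = comp (extendBy X W) V := by
  funext e
  by_cases h : X e = 0 <;> simp [extendBy, comp, h]

lemma isFullAt_faceSystem_iff {L : Set (U → SignType)} (hL : Composition L) {X : U → SignType}
    (hX : X ∈ L) {W : {e // X e = 0} → SignType} :
    IsFullAt (faceSystem L X) W ↔ IsFullAt L (extendBy X W) := by
  constructor
  · intro h V
    rw [← extendBy_comp, ← mem_faceSystem_iff hL hX]
    exact h _
  · intro h V
    rw [mem_faceSystem_iff hL hX]
    have := extendBy_comp X W (extendBy X V)
    simp only [extendBy_apply] at this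
    rw [this]
    exact h _

/-- Z ↦ X∘(−Z) is negation on the zero set of `X`, so face symmetry becomes symmetry. -/
lemma isOM_faceSystem {L : Set (U → SignType)} (hL : IsCOM L) {X : U → SignType} (hX : X ∈ L) :
    IsOM (faceSystem L X) := by
  have hC := hL.composition
  refine ⟨fun W hW V hV => ?_, fun W hW V hV e he => ?_, fun W hW => ?_⟩
  · rw [mem_faceSystem_iff hC hX] at hW hV ⊢
    have := extendBy_comp X W (extendBy X V)
    simp only [extendBy_apply] at this
    rw [this]
    exact hC _ hW _ hV
  · obtain ⟨W, hW, rfl⟩ := hW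
    obtain ⟨V, hV, rfl⟩ := hV
    obtain ⟨Z, hZ, hZe, hZf⟩ := strongElimination_face hL hX W hW V hV e.1 he
    exact ⟨_, ⟨Z, hZ, rfl⟩, hZe, fun f hf => hZf f.1 hf⟩
  · rw [mem_faceSystem_iff hC hX] at hW ⊢
    convert hL.face_symmetry X hX _ hW using 1
    funext e
    by_cases h : X e = 0 <;> simp [extendBy, comp, h]

lemma isSimple_faceSystem {L : Set (U → SignType)} (hs : IsSimple L) {X : U → SignType} :
    IsSimple (faceSystem L X) := by
  have hmem : ∀ Y ∈ L, (fun e => Y e.1) ∈ faceSystem L X := fun Y hY =>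
    ⟨comp X Y, ⟨Y, hY, rfl⟩, funext fun e => (comp_apply_of_eq_zero e.2 Y).symm⟩
  refine ⟨fun e s => ?_, fun e f hef => ?_⟩
  · obtain ⟨Y, hY, hYe⟩ := hs.all_signs e.1 s
    exact ⟨_, hmem Y hY, hYe⟩
  · obtain ⟨Y, hY, Y', hY', h, h'⟩ := hs.no_parallel e.1 f.1 fun h => hef (Subtype.ext h)
    exact ⟨_, hmem Y hY, _, hmem Y' hY', h, h'⟩

/-! ### Characterizations of complexes of uniform oriented matroids -/

/-- The faces of covectors lying strictly above another covector are full. -/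
def HasFullProperFaces (L : Set (U → SignType)) : Prop :=
  ∀ X ∈ L, ∀ Y ∈ L, SignLE X Y → X ≠ Y → IsFullAt L Y

lemma SignLE.antisymm {X Y : U → SignType} (h : SignLE X Y) (h' : SignLE Y X) : X = Y := by
  funext e
  rcases h e with h | h
  · rcases h' e with h' | h'
    · rw [h, h']
    · exact h'.symm
  · exact h

/-- Passing to faces reverses the order, so maximal faces belong to minimal covectors. -/
lemma maximal_face_iff {L : Set (U → SignType)} (hL : Composition L) {Y : U → SignType}
    (hY : Y ∈ L) : Maximal (IsFace L) (face L Y) ↔ ∀ X ∈ L, SignLE X Y → X = Y := by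
  constructor
  · intro h X hX hXY
    have := h.2 ⟨X, hX, rfl⟩ ((face_subset_face_iff hL hX hY).2 hXY)
    exact hXY.antisymm ((face_subset_face_iff hL hY hX).1 this)
  · refine fun h => ⟨⟨Y, hY, rfl⟩, ?_⟩
    rintro _ ⟨X, hX, rfl⟩ hle
    rw [h X hX ((face_subset_face_iff hL hX hY).1 hle)]

lemma isCUOM_iff_hasFullProperFaces [Fintype U] {L : Set (U → SignType)} (hL : IsCOM L)
    (hs : IsSimple L) : IsCUOM L ↔ HasFullProperFaces L := by
  have hC := hL.composition
  constructor
  · intro h X hX Y hY hXY hne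
    obtain ⟨_, hle, hmax⟩ :=
      (Set.toFinite {F | IsFace L F}).exists_le_maximal (show IsFace L (face L X) from ⟨X, hX, rfl⟩)
    obtain ⟨Q, hQ, rfl⟩ := hmax.prop
    have hQX := (face_subset_face_iff hC hQ hX).1 hle
    have hQY := hQX.trans hXY
    obtain ⟨r, hr⟩ := h.uniform Q hQ hmax
    have hYQ := hQY.extendBy_restrict
    rw [← hYQ, ← isFullAt_faceSystem_iff hC hQ]
    -- If Y vanished on the zero set of Q, then Y ≤ Q ≤ X, contradicting X < Y.
    refine hr.isFullAt ((mem_faceSystem_iff hC hQ).2 (by rwa [hYQ])) fun h0 => hne ?_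
    refine hXY.antisymm (SignLE.trans (fun e => ?_) hQX)
    by_cases he : Q e = 0
    · exact Or.inl (congrFun h0 ⟨e, he⟩)
    · exact Or.inr (hQY.apply_eq he)
  · refine fun h => ⟨hL, hs, fun X hX _ => isUOM_of_isFullAt (isOM_faceSystem hL hX)
      (isSimple_faceSystem hs) fun W hW hW0 => ?_⟩
    rw [isFullAt_faceSystem_iff hC hX]
    rw [mem_faceSystem_iff hC hX] at hW
    refine h X hX _ hW (signLE_extendBy X W) fun h0 => hW0 (funext fun e => ?_)
    rw [← extendBy_apply W e, ← h0]
    exact e.2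

lemma forall_isHypercube_iff_hasFullProperFaces [Fintype U] [DecidableEq U]
    {L : Set (U → SignType)} (hL : IsCOM L) (hs : IsSimple L) :
    (∀ F, IsFace L F → ¬ Maximal (IsFace L) F → IsHypercube (topeGraph F)) ↔
      HasFullProperFaces L := by
  have hC := hL.composition
  have hfull := hasFullTopes_of_isSimple hC hs
  constructor
  · intro h X hX Y hY hXY hne
    refine isFullAt_of_isHypercube hL hfull hY (h _ ⟨Y, hY, rfl⟩ fun hmax => ?_)
    exact hne ((maximal_face_iff hC hY).1 hmax X hX hXY)
  · rintro h _ ⟨Y, hY, rfl⟩ hmax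
    rw [maximal_face_iff hC hY] at hmax
    push Not at hmax
    obtain ⟨X, hX, hXY, hne⟩ := hmax
    exact (h X hX Y hY hXY hne).isHypercube hC hfull hY

lemma forall_isAmplePartialCube_iff_hasFullProperFaces [Fintype U] [DecidableEq U]
    {L : Set (U → SignType)} (hL : IsCOM L) (hs : IsSimple L) :
    (∀ e : U, IsAmplePartialCube (topeFamily (posHalfCarrier L e)) ∧
      IsAmplePartialCube (topeFamily (negHalfCarrier L e))) ↔ HasFullProperFaces L := by
  have hC := hL.composition
  have hfull := hasFullTopes_of_isSimple hC hs
  constructor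
  · intro h X hX Y hY hXY hne
    -- At such an `e`, X vanishes and Y does not, which places Y in a half-carrier of `e`.
    obtain ⟨e, he⟩ := Function.ne_iff.1 hne
    have hXe := (hXY e).resolve_right he
    have hYe : Y e ≠ 0 := fun h0 => he (hXe.trans h0.symm)
    have hY' : Y ∈ halfCarrier L e (Y e) :=
      (mem_halfCarrier_iff hC).2 ⟨hY, rfl, X, hX, hXe, hXY⟩
    refine isFullAt_of_isAmple_halfCarrier hL hfull hYe ?_ hY'
    rcases sign_eq_or_eq_neg hYe one_ne_zero with h1 | h1
    · rw [h1]
      exact (h e).1.ample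
    · rw [h1]
      exact (h e).2.ample
  · intro h e
    have hp := isAmple_halfCarrier hL hfull h (e := e) (s := 1) (by decide)
    have hn := isAmple_halfCarrier hL hfull h (e := e) (s := -1) (by decide)
    exact ⟨⟨hp.isIsometric, hp⟩, ⟨hn.isIsometric, hn⟩⟩

end SignSystem

theorem mainTheorem7 {U : Type*} [Fintype U] [DecidableEq U] (L : Set (U → SignType))
    (hL : SignSystem.IsCOM L) (hsimple : SignSystem.IsSimple L) :
    List.TFAE [
      SignSystem.IsCUOM L,
      ∀ F, SignSystem.IsFace L F → ¬ Maximal (SignSystem.IsFace L) F →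
        SignSystem.IsHypercube (SignSystem.topeGraph F),
      ∀ e : U,
        SignSystem.IsAmplePartialCube
          (SignSystem.topeFamily (SignSystem.posHalfCarrier L e)) ∧
        SignSystem.IsAmplePartialCube
          (SignSystem.topeFamily (SignSystem.negHalfCarrier L e))] := by
  rw [SignSystem.isCUOM_iff_hasFullProperFaces hL hsimple,
    SignSystem.forall_isHypercube_iff_hasFullProperFaces hL hsimple,
    SignSystem.forall_isAmplePartialCube_iff_hasFullProperFaces hL hsimple]
  tfae_have 1 ↔ 2 := Iff.rfl
  tfae_have 2 ↔ 3 := Iff.rfl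
  tfae_finish
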